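/- **Setting.** A transmitter with $N$ antennas serves $K\ge 1$ single-antenna receivers with channels $\mathbf h_k\in\mathbb C^N$, antenna and decoding noise variances $\sigma_{a_k}^2,\sigma_{d_k}^2>0$, SINR demands $\bar\gamma_k>0$, and power budget $P_T$. For precoding vectors $\mathbf f_k\in\mathbb C^N$ and power-splitting ratios $\rho_k$ let $$\mathrm{SINR}_k=\frac{\rho_k|\mathbf h_k^{\rm H}\mathbf f_k|^2}{\rho_k\sum_{j\ne k}|\mathbf h_k^{\rm H}\mathbf f_j|^2+\rho_k\sigma_{a_k}^2+\sigma_{d_k}^2},\qquad P_{R_k}=(1-\rho_k)\Big(\sum_{j=1}^K|\mathbf h_k^{\rm H}\mathbf f_j|^2+\sigma_{a_k}^2\Big),$$ and let the harvested power be $P_{H_k}=\mathcal F(P_{R_k})$, where $\mathcal F$ is a (generally nonlinear) non-decreasing function on $[0,\infty)$, the same for all receivers. Consider $$\mathcal{OP}:\ \max_{\{\mathbf f_k,\rho_k\}}\ \min_k P_{H_k}\quad\text{s.t. } \mathrm{SINR}_k\ge\bar\gamma_k\ \forall k,\ \ \sum_k\|\mathbf f_k\|^2\le P_T,\ \ 0\le\rho_k\le1\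 \forall k,$$ and its semidefinite relaxation $$\mathcal{OP}1:\ \max_{\mathcal P,\{\mathbf F_k,\rho_k\}}\ \mathcal P\quad\text{s.t. } \sum_j\mathbf h_k^{\rm H}\mathbf F_j\mathbf h_k+\sigma_{a_k}^2\ge\frac{\mathcal P}{1-\rho_k},\ \ \frac{\mathbf h_k^{\rm H}\mathbf F_k\mathbf h_k}{\bar\gamma_k}-\sum_{j\ne k}\mathbf h_k^{\rm H}\mathbf F_j\mathbf h_k\ge\sigma_{a_k}^2+\frac{\sigma_{d_k}^2}{\rho_k},\ \ 0\le\rho_k\le1,\ \ \mathbf F_k\succeq0\ \ \forall k,\ \ \sum_k\mathrm{tr}\,\mathbf F_k\le P_T,$$ where for $\rho_k=1$ the first constraint is read as $\mathcal P\le 0$, and for $\rho_k=0$ the second is not satisfied. **Theorem.** $\mathcal{OP}1$ is an equivalent formulation of $\mathcal{OP}$, and it has a unique globally optimal solution whenever the problem is feasible. Precisely: 1. For all $\mathcal P$, $\{\mathbf f_k,\rho_k\}$: $(\mathcal P,\{\mathbf f_k\mathbf f_k^{\rm H},\rho_k\})$ is feasible for $\mathcal{OP}1$ if and only if $\{\mathbf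 f_k,\rho_k\}$ is feasible for $\mathcal{OP}$ and $\mathcal P\le\min_k P_{R_k}$. 2. $\mathcal{OP}1$ is feasible if and only if $\mathcal{OP}$ is feasible. 3. If they are feasible, $\mathcal{OP}1$ has exactly one globally optimal solution $(\mathcal P^*,\{\mathbf F_k^*,\rho_k^*\})$. There are vectors $\mathbf f_k^*$ with $\mathbf F_k^*=\mathbf f_k^*\mathbf f_k^{*{\rm H}}$ for all $k$, and for every such choice $\{\mathbf f_k^*,\rho_k^*\}$ is a globally optimal solution of $\mathcal{OP}$ with optimal value $\mathcal F(\mathcal P^*)$. 4. If, in addition, $\mathcal F(x)<\mathcal F(\mathcal P^*)$ for all $0\le x<\mathcal P^*$ (for instance if $\mathcal F$ is strictly increasing), then conversely every globally optimal solution $\{\mathbf f_k,\rho_k\}$ of $\mathcal{OP}$ satisfies $\mathbf f_k\mathbf f_k^{\rm H}=\mathbf F_k^*$ and $\rho_k=\rho_k^*$ for all $k$. -/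

import Mathlib

open scoped Matrix ComplexOrder

noncomputable section

/-- Data of a MISO SWIPT multicasting system with `K` single-antenna receivers and an `N`-antenna
transmitter: channel vectors `h k`, standard deviations `σa k` (antenna noise) and `σd k`
(decoding noise), SINR demands `γ k`, and the transmit power budget `PT`. -/
structure SwiptSystem (K N : ℕ) where
  h : Fin K → EuclideanSpace ℂ (Fin N)
  σa : Fin K → ℝ
  σd : Fin K → ℝ
  γ : Fin K → ℝ
  PT : ℝ
  σa_pos : ∀ k, 0 < σa k
  σd_pos : ∀ k, 0 < σd k
  γ_pos : ∀ k, 0 < γ k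

namespace SwiptSystem

variable {K N : ℕ}

/-- The rank-one matrix `f fᴴ`. -/
def outer (f : EuclideanSpace ℂ (Fin N)) : Matrix (Fin N) (Fin N) ℂ :=
  Matrix.vecMulVec f.ofLp (star f.ofLp)

/-- `|h_kᴴ f|²`. -/
def gain (S : SwiptSystem K N) (k : Fin K) (f : EuclideanSpace ℂ (Fin N)) : ℝ :=
  ‖inner ℂ (S.h k) f‖ ^ 2

/-- The quadratic form `h_kᴴ F h_k` (its real part, which is its value for Hermitian `F`). -/
def quad (S : SwiptSystem K N) (k : Fin K) (F : Matrix (Fin N) (Fin N) ℂ) : ℝ :=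
  (star (S.h k).ofLp ⬝ᵥ (F *ᵥ (S.h k).ofLp)).re

/-- The SINR of receiver `k`. Its denominator is positive for `0 ≤ ρ k`. -/
def SINR (S : SwiptSystem K N) (f : Fin K → EuclideanSpace ℂ (Fin N)) (ρ : Fin K → ℝ)
    (k : Fin K) : ℝ :=
  (ρ k * S.gain k (f k)) /
    (ρ k * (∑ j ∈ Finset.univ.erase k, S.gain k (f j)) + ρ k * S.σa k ^ 2 + S.σd k ^ 2)

/-- The RF power available for energy harvesting at receiver `k`. -/
def rxPower (S : SwiptSystem K N) (f : Fin K → EuclideanSpace ℂ (Fin N)) (ρ : Fin K → ℝ)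
    (k : Fin K) : ℝ :=
  (1 - ρ k) * ((∑ j, S.gain k (f j)) + S.σa k ^ 2)

/-- Feasible points of the original problem `OP`. -/
structure FeasibleOP (S : SwiptSystem K N) (f : Fin K → EuclideanSpace ℂ (Fin N))
    (ρ : Fin K → ℝ) : Prop where
  sinr : ∀ k, S.γ k ≤ S.SINR f ρ k
  budget : ∑ k, ‖f k‖ ^ 2 ≤ S.PT
  split : ∀ k, 0 ≤ ρ k ∧ ρ k ≤ 1

/-- Objective of `OP`: the minimum over the receivers of the harvested power `EH (rxPower)`. -/
def objOP (S : SwiptSystem K N) (EH : ℝ → ℝ) (f : Fin K → EuclideanSpace ℂ (Fin N))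
    (ρ : Fin K → ℝ) : ℝ :=
  ⨅ k, EH (S.rxPower f ρ k)

/-- Globally optimal solutions of `OP`. -/
def IsOptimalOP (S : SwiptSystem K N) (EH : ℝ → ℝ) (f : Fin K → EuclideanSpace ℂ (Fin N))
    (ρ : Fin K → ℝ) : Prop :=
  S.FeasibleOP f ρ ∧ ∀ f' ρ', S.FeasibleOP f' ρ' → S.objOP EH f' ρ' ≤ S.objOP EH f ρ

/-- Feasible points of the semidefinite relaxation `OP1`.
At the endpoints of `[0, 1]` the two fractions are read by continuous extension: at `ρ k = 1` the
constraint with `P / (1 - ρ k)` becomes `P ≤ 0` (as for its cleared form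
`P ≤ (1 - ρ k) * (…)`), and the one with `σd² / ρ k` fails at `ρ k = 0`. -/
structure FeasibleOP1 (S : SwiptSystem K N) (P : ℝ) (F : Fin K → Matrix (Fin N) (Fin N) ℂ)
    (ρ : Fin K → ℝ) : Prop where
  split : ∀ k, 0 ≤ ρ k ∧ ρ k ≤ 1
  harvest : ∀ k, (ρ k < 1 → P / (1 - ρ k) ≤ (∑ j, S.quad k (F j)) + S.σa k ^ 2) ∧
    (ρ k = 1 → P ≤ 0)
  sinr : ∀ k, 0 < ρ k ∧
    S.σa k ^ 2 + S.σd k ^ 2 / ρ k ≤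
      S.quad k (F k) / S.γ k - ∑ j ∈ Finset.univ.erase k, S.quad k (F j)
  budget : ∑ k, (F k).trace.re ≤ S.PT
  psd : ∀ k, (F k).PosSemidef

/-- Globally optimal solutions of `OP1` (maximize `P`). -/
def IsOptimalOP1 (S : SwiptSystem K N) (P : ℝ) (F : Fin K → Matrix (Fin N) (Fin N) ℂ)
    (ρ : Fin K → ℝ) : Prop :=
  S.FeasibleOP1 P F ρ ∧ ∀ P' F' ρ', S.FeasibleOP1 P' F' ρ' → P' ≤ P

end SwiptSystem

end

/-! ### Perturbation, separation and scalar inequalities -/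

section

open Filter Topology

/-! With denominators cleared, each user has two constraints of product type, `P ≤ (1 - ρ) * (total
+ σa²)` and `σd² ≤ ρ * (margin - σa²)`. At an optimum no change of the `F j` can, after readjusting
the `ρ k`, help every user at once. To first order a user is helped when the linear functional
`balance` increases, so separating convex sets yields multipliers `μ ≥ 0` and a power price `ν > 0`
(`IsOptimalOP1.exists_multipliers`).

The Lagrangian splits into positive semidefinite blocks `ν I + ∑ μ_k w_k h_k h_kᴴ - μ_j (1 + 1/γ_j)
h_j h_jᴴ`, and `F j` lives on the kernel of block `j`. The `w_k` may be negative, but the blocks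
differ only in their last term. If `u` is in the kernel of block `j` and `μ_j |h_jᴴ u|² = 0`, the
common part vanishes at `u`; the other blocks then force every `μ_i |h_iᴴ u|² = 0`, leaving `ν ‖u‖²
= 0` (`eq_zero_of_lagrangian_eq_zero`). Hence each `F j` has rank one, and the relaxation is exact.

The same fact makes every SINR constraint tight (`IsOptimalOP1.margin_tight`). For two optima the
midpoint is optimal: different `ρ` would leave SINR slack there, and its multipliers force both
families onto common directions. The remaining scalars solve a linear system with a unique positive
solution. Existence is compactness; monotonicity of `EH` transfers the result to `OP`. -/

/-- Moving `ρ` trades one product against the other. Compensating exactly for `dT` in `(1 - ρ) * T`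
leaves a first-order gain `ρ * X` in `ρ * s`; a positive gain can be shared so that both products
grow. -/
theorem exists_direction_of_pos {T s ρ P d dT ds : ℝ} (hT : 0 < T) (hs : 0 < s) (hρ : 0 < ρ)
    (hρ1 : ρ ≤ 1) (hP : P ≤ (1 - ρ) * T) (hd : d ≤ ρ * s)
    (h : 0 < ds + s * (1 - ρ) / (ρ * T) * dT) :
    ∃ δ, ∀ᶠ t in 𝓝[>] (0 : ℝ), (0 ≤ ρ + t * δ ∧ ρ + t * δ ≤ 1) ∧
      P < (1 - (ρ + t * δ)) * (T + t * dT) ∧ d ≤ (ρ + t * δ) * (s + t * ds) := by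
  -- `ε` hands half of the gain back to the first product; the other half is `e2`.
  set X := ds + s * (1 - ρ) / (ρ * T) * dT with hX
  set ε := ρ * X / (2 * s) with hε
  have hε0 : 0 < ε := by positivity
  set δ := (1 - ρ) * dT / T - ε with hδ
  have e1 : (1 - ρ) * dT - δ * T = ε * T := by
    rw [hδ]; field_simp; ring
  have e2 : ρ * ds + δ * s = ρ * X / 2 := by
    rw [hδ, hε, hX]; field_simp; ring
  have c1 : ∀ᶠ t in 𝓝[>] (0 : ℝ), 0 < ρ + t * δ := by
    refine (ContinuousAt.eventually_lt (f := fun _ : ℝ => (0 : ℝ)) (g := fun t => ρ + t * δ)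
      (by fun_prop) (by fun_prop) (by simpa using hρ)).filter_mono nhdsWithin_le_nhds
  have c2 : ∀ᶠ t in 𝓝[>] (0 : ℝ), t * (δ * dT) < ε * T := by
    refine (ContinuousAt.eventually_lt (f := fun t : ℝ => t * (δ * dT)) (g := fun _ => ε * T)
      (by fun_prop) (by fun_prop) (by simp; positivity)).filter_mono nhdsWithin_le_nhds
  have c3 : ∀ᶠ t in 𝓝[>] (0 : ℝ), 0 < ρ * X / 2 + t * (δ * ds) := by
    refine (ContinuousAt.eventually_lt (f := fun _ : ℝ => (0 : ℝ))
      (g := fun t => ρ * X / 2 + t * (δ * ds))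
      (by fun_prop) (by fun_prop) (by simp; positivity)).filter_mono nhdsWithin_le_nhds
  have c4 : ∀ᶠ t in 𝓝[>] (0 : ℝ), ρ + t * δ ≤ 1 := by
    rcases hρ1.lt_or_eq with h1 | h1
    · refine (ContinuousAt.eventually_lt (g := fun _ : ℝ => (1 : ℝ)) (f := fun t => ρ + t * δ)
        (by fun_prop) (by fun_prop) (by simpa using h1)).filter_mono nhdsWithin_le_nhds |>.mono
        fun t ht => ht.le
    -- At `ρ = 1` the compensating term of `δ` vanishes, so `δ = -ε` points into the interval.
    · filter_upwards [self_mem_nhdsWithin] with t ht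
      have : δ = -ε := by rw [hδ, h1]; simp
      rw [this, h1]
      have : 0 < t := ht
      nlinarith
  refine ⟨δ, ?_⟩
  filter_upwards [c1, c2, c3, c4, self_mem_nhdsWithin] with t h1 h2 h3 h4 h5
  have h5 : 0 < t := h5
  refine ⟨⟨h1.le, h4⟩, ?_, ?_⟩
  · have : (1 - (ρ + t * δ)) * (T + t * dT) =
        (1 - ρ) * T + t * (((1 - ρ) * dT - δ * T) - t * (δ * dT)) := by ring
    rw [this, e1]
    have := mul_pos h5 (sub_pos.mpr h2)
    linarith
  · have : (ρ + t * δ) * (s + t * ds) =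
        ρ * s + t * ((ρ * ds + δ * s) + t * (δ * ds)) := by ring
    rw [this, e2]
    have := mul_pos h5 h3
    linarith

theorem eventually_of_strict {T s ρ P d : ℝ} (dT ds : ℝ)
    (hP : P < (1 - ρ) * T) (hd : d < ρ * s) :
    ∀ᶠ t in 𝓝[>] (0 : ℝ), P < (1 - ρ) * (T + t * dT) ∧ d ≤ ρ * (s + t * ds) := by
  have c1 : ∀ᶠ t in 𝓝[>] (0 : ℝ), P < (1 - ρ) * (T + t * dT) := by
    refine (ContinuousAt.eventually_lt (f := fun _ : ℝ => P)
      (g := fun t => (1 - ρ) * (T + t * dT))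
      (by fun_prop) (by fun_prop) (by simpa using hP)).filter_mono nhdsWithin_le_nhds
  have c2 : ∀ᶠ t in 𝓝[>] (0 : ℝ), d < ρ * (s + t * ds) := by
    refine (ContinuousAt.eventually_lt (f := fun _ : ℝ => d)
      (g := fun t => ρ * (s + t * ds))
      (by fun_prop) (by fun_prop) (by simpa using hd)).filter_mono nhdsWithin_le_nhds
  exact (c1.and c2).mono fun t h => ⟨h.1, h.2.le⟩

/-- A convex set through the origin of `ℝⁿ` without points that are positive on `s` admits a
supporting functional with nonnegative weights carried by `s`. -/
theorem exists_weights_of_convex {ι : Type*} [Fintype ι] {T : Set (ι → ℝ)} (hT : Convex ℝ T)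
    (h0 : (0 : ι → ℝ) ∈ T) (s : Set ι) (hs : ∀ y ∈ T, ∃ i ∈ s, y i ≤ 0) :
    ∃ μ : ι → ℝ, (∀ i, 0 ≤ μ i) ∧ (∀ i ∉ s, μ i = 0) ∧ (∃ i, 0 < μ i) ∧
      ∀ y ∈ T, ∑ i, μ i * y i ≤ 0 := by
  classical
  have hU : {x : ι → ℝ | ∀ i ∈ s, 0 < x i} = s.pi fun _ => Set.Ioi 0 := rfl
  obtain ⟨f, u, hf, hu⟩ := geometric_hahn_banach_open
    (s := {x : ι → ℝ | ∀ i ∈ s, 0 < x i}) (t := T)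
    (by rw [hU]; exact convex_pi fun i _ => convex_Ioi 0)
    (by rw [hU]; exact isOpen_set_pi s.toFinite fun _ _ => isOpen_Ioi) hT
    (Set.disjoint_left.mpr fun x hx hxT => by
      obtain ⟨i, hi, hle⟩ := hs x hxT
      exact absurd (hx i hi) (not_lt.mpr hle))
  have hu0 : u ≤ 0 := by simpa using hu 0 h0
  have hfs : ∀ x : ι → ℝ, f x = ∑ i, x i * f (Pi.single i 1) := fun x => by
    conv_lhs => rw [pi_eq_sum_univ' x]
    simp [map_sum]
  have hcone : ∀ x : ι → ℝ, (∀ i ∈ s, 0 ≤ x i) → f x ≤ 0 := fun x hx => by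
    by_contra! hpos
    have h1 : f (1 : ι → ℝ) < 0 := (hf 1 fun i _ => by simp).trans_le hu0
    -- The shift enters the open cone and brings the value of `f` to exactly `0`, against `f < u ≤
    -- 0` there.
    have := hf (x + (f x / (-f 1)) • 1) fun i hi => by
      have : 0 < f x / (-f 1) := div_pos hpos (by linarith)
      simpa using add_pos_of_nonneg_of_pos (hx i hi) this
    rw [map_add, map_smul, smul_eq_mul] at this
    have h2 : f x / (-f 1) * f 1 = - f x := by
      rw [div_neg, neg_mul, div_mul_cancel₀ _ h1.ne]
    linarith
  have hu0' : 0 ≤ u := by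
    by_contra! hneg
    have h1 : f (1 : ι → ℝ) < 0 := (hf 1 fun i _ => by simp).trans_le hu0
    have := hf ((u / (f 1)) • 1) fun i hi => by
      simpa using div_pos_of_neg_of_neg hneg h1
    rw [map_smul, smul_eq_mul, div_mul_cancel₀ _ h1.ne] at this
    exact lt_irrefl _ this
  refine ⟨fun i => -f (Pi.single i 1), fun i => ?_, fun i hi => ?_, ?_, fun y hy => ?_⟩
  · have := hcone (Pi.single i 1) fun j _ => by
      by_cases h : j = i <;> simp [h]
    linarith
  -- Coordinates outside `s` are unconstrained in the cone, so both signs are admissible and the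
  -- weight vanishes.
  · have hz : ∀ j ∈ s, j ≠ i := fun j hj h => hi (h ▸ hj)
    have h1 := hcone (Pi.single i 1) fun j hj => by simp [hz j hj]
    have h2 := hcone (-Pi.single i 1) fun j hj => by simp [hz j hj]
    rw [map_neg] at h2
    linarith
  · by_contra! h
    have h1 : f (1 : ι → ℝ) < 0 := (hf 1 fun i _ => by simp).trans_le hu0
    rw [hfs] at h1
    have : 0 ≤ ∑ i, (1 : ι → ℝ) i * f (Pi.single i 1) :=
      Finset.sum_nonneg fun i _ => by have := h i; simp; linarith
    linarith
  · have h1 := hu y hy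
    rw [hfs] at h1
    have : ∑ i, -f (Pi.single i 1) * y i = -∑ i, y i * f (Pi.single i 1) := by
      rw [← Finset.sum_neg_distrib]; exact Finset.sum_congr rfl fun i _ => by ring
    rw [this]; linarith

/-- Convexity of the region above a hyperbola: by AM-GM the cross terms satisfy `x * U + y * T ≥ 2 *
P`. -/
theorem cross_mul_ge {P x y T U : ℝ} (hP : 0 ≤ P) (hx : 0 ≤ x) (hy : 0 ≤ y) (hT : 0 ≤ T)
    (hU : 0 ≤ U) (h1 : P ≤ x * T) (h2 : P ≤ y * U) :
    P ≤ (2⁻¹ * x + 2⁻¹ * y) * (2⁻¹ * T + 2⁻¹ * U) := by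
  have h : (2 * P) ^ 2 ≤ (x * U + y * T) ^ 2 := by
    have := mul_le_mul h1 h2 hP (by positivity)
    nlinarith [sq_nonneg (x * U - y * T)]
  have := le_of_sq_le_sq h (by positivity)
  nlinarith

/-- Strict convexity of `x ↦ d / x`; this is what makes the splitting ratios unique. -/
theorem cross_mul_gt {d x y T U : ℝ} (hd : 0 < d) (hx : 0 < x) (hy : 0 < y) (hxy : x ≠ y)
    (h1 : d ≤ x * T) (h2 : d ≤ y * U) :
    d < (2⁻¹ * x + 2⁻¹ * y) * (2⁻¹ * T + 2⁻¹ * U) := by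
  have hT : d / x ≤ T := (div_le_iff₀' hx).mpr h1
  have hU : d / y ≤ U := (div_le_iff₀' hy).mpr h2
  have : d < (2⁻¹ * x + 2⁻¹ * y) * (2⁻¹ * (d / x) + 2⁻¹ * (d / y)) := by
    have : (2⁻¹ * x + 2⁻¹ * y) * (2⁻¹ * (d / x) + 2⁻¹ * (d / y)) - d =
        d * (x - y) ^ 2 / (4 * x * y) := by field_simp; ring
    have h3 : 0 < d * (x - y) ^ 2 / (4 * x * y) := by
      have : 0 < (x - y) ^ 2 := by have := sub_ne_zero.mpr hxy; positivity
      positivity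
    linarith
  refine this.trans_le ?_
  gcongr

/-- Uniqueness of positive solutions of `c i * x i - ∑ j, g i j * x j = a i` when `g ≥ 0`,
`a > 0`. -/
theorem le_of_diag_sub_eq {ι : Type*} [Fintype ι] [Nonempty ι] {g : ι → ι → ℝ} {c x y : ι → ℝ}
    (hg : ∀ i j, 0 ≤ g i j) (hx : ∀ i, 0 < x i)
    (ha : ∀ i, 0 < c i * x i - ∑ j, g i j * x j)
    (h : ∀ i, c i * x i - ∑ j, g i j * x j = c i * y i - ∑ j, g i j * y j) : ∀ i, y i ≤ x i := by
  -- Maximum-ratio argument: if the largest ratio `θ` exceeds `1`, row `k` at `y` is at least `θ`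
  -- times the positive row at `x`, so the two cannot agree.
  obtain ⟨k, hk⟩ := Finite.exists_max fun i => y i / x i
  set θ := y k / x k with hθ
  have hle : ∀ i, y i ≤ θ * x i := fun i => (div_le_iff₀ (hx i)).mp (hk i)
  have heq : y k = θ * x k := by rw [hθ, div_mul_cancel₀ _ (hx k).ne']
  rcases le_or_gt θ 1 with h1 | h1
  · intro i
    exact (hle i).trans (by have := hx i; nlinarith)
  · exfalso
    have h2 : ∑ j, g k j * y j ≤ θ * ∑ j, g k j * x j := by
      rw [Finset.mul_sum]
      refine Finset.sum_le_sum fun j _ => ?_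
      have := mul_le_mul_of_nonneg_left (hle j) (hg k j)
      linarith
    have h3 := h k
    have h4 := ha k
    rw [heq] at h3
    nlinarith [mul_pos (sub_pos.mpr h1) h4]

end

noncomputable section

namespace SwiptSystem

variable {K N : ℕ}

open Filter Topology

section

/-! ### Rank-one matrices and quadratic forms -/

/-- Reduces statements about linear functionals on positive semidefinite matrices to quadratic forms
in vectors. The vectors are the conjugated rows of a factor `B` in `M = Bᴴ * B`. -/
theorem exists_sum_outer {M : Matrix (Fin N) (Fin N) ℂ} (hM : M.PosSemidef) :
    ∃ v : Fin N → EuclideanSpace ℂ (Fin N), M = ∑ i, outer (v i) := by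
  obtain ⟨B, rfl⟩ : ∃ B : Matrix (Fin N) (Fin N) ℂ, M = Bᴴ * B := by
    open scoped MatrixOrder Matrix.Norms.L2Operator in
    exact CStarAlgebra.nonneg_iff_eq_star_mul_self.mp (Matrix.PosSemidef.nonneg hM)
  refine ⟨fun i => WithLp.toLp 2 (fun a => star (B i a)), ?_⟩
  ext a b
  simp [outer, Matrix.sum_apply, Matrix.vecMulVec_apply, Matrix.mul_apply]

theorem posSemidef_outer (v : EuclideanSpace ℂ (Fin N)) : (outer v).PosSemidef :=
  Matrix.posSemidef_vecMulVec_self_star _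

theorem outer_smul (c : ℂ) (v : EuclideanSpace ℂ (Fin N)) :
    outer (c • v) = (‖c‖ ^ 2 : ℝ) • outer v := by
  ext a b
  simp only [outer, Matrix.vecMulVec_apply, Matrix.smul_apply, Pi.star_apply, WithLp.ofLp_smul,
    Pi.smul_apply, smul_eq_mul, star_mul', Complex.real_smul]
  have : ((‖c‖ ^ 2 : ℝ) : ℂ) = c * star c := by
    rw [Complex.star_def, Complex.mul_conj, Complex.normSq_eq_norm_sq]
  rw [this]; ring

theorem trace_outer (v : EuclideanSpace ℂ (Fin N)) : (outer v).trace.re = ‖v‖ ^ 2 := by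
  rw [EuclideanSpace.norm_sq_eq, outer, Matrix.trace_vecMulVec, dotProduct, Complex.re_sum]
  refine Finset.sum_congr rfl fun i _ => ?_
  rw [Pi.star_apply, Complex.star_def, Complex.mul_conj, Complex.normSq_eq_norm_sq,
    Complex.ofReal_re]

variable (S : SwiptSystem K N)

theorem quad_outer (k : Fin K) (v : EuclideanSpace ℂ (Fin N)) :
    S.quad k (outer v) = S.gain k v := by
  have h1 : (v.ofLp ⬝ᵥ star (S.h k).ofLp) = inner ℂ (S.h k) v := by
    rw [EuclideanSpace.inner_eq_star_dotProduct]
  have h2 : (star v.ofLp ⬝ᵥ (S.h k).ofLp) = star (inner ℂ (S.h k) v) := by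
    rw [← h1, Matrix.star_dotProduct, dotProduct_comm]
  rw [quad, gain, outer, Matrix.vecMulVec_mulVec, h2]
  rw [dotProduct_smul, dotProduct_comm _ v.ofLp, h1, op_smul_eq_mul,
    Complex.star_def, Complex.mul_conj, Complex.normSq_eq_norm_sq, Complex.ofReal_re]

theorem quad_add (k : Fin K) (A B : Matrix (Fin N) (Fin N) ℂ) :
    S.quad k (A + B) = S.quad k A + S.quad k B := by
  simp [quad, Matrix.add_mulVec, dotProduct_add]

theorem quad_smul (k : Fin K) (t : ℝ) (A : Matrix (Fin N) (Fin N) ℂ) :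
    S.quad k (t • A) = t * S.quad k A := by
  simp [quad, Matrix.smul_mulVec, dotProduct_smul]

theorem quad_zero (k : Fin K) : S.quad k 0 = 0 := by simp [quad]

theorem quad_sum {ι : Type*} (s : Finset ι) (k : Fin K) (A : ι → Matrix (Fin N) (Fin N) ℂ) :
    S.quad k (∑ i ∈ s, A i) = ∑ i ∈ s, S.quad k (A i) := by
  classical
  induction s using Finset.induction_on with
  | empty => simp [quad_zero]
  | insert a s ha ih => rw [Finset.sum_insert ha, Finset.sum_insert ha, quad_add, ih]

theorem gain_nonneg (k : Fin K) (v : EuclideanSpace ℂ (Fin N)) : 0 ≤ S.gain k v := by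
  unfold gain; positivity

theorem quad_nonneg (k : Fin K) {A : Matrix (Fin N) (Fin N) ℂ} (hA : A.PosSemidef) :
    0 ≤ S.quad k A := by
  obtain ⟨v, rfl⟩ := exists_sum_outer hA
  rw [quad_sum]
  exact Finset.sum_nonneg fun i _ => by rw [quad_outer]; exact S.gain_nonneg k _

theorem gain_parallelogram (k : Fin K) (u v : EuclideanSpace ℂ (Fin N)) :
    S.gain k (u + v) + S.gain k (u - v) = 2 * (S.gain k u + S.gain k v) := by
  simp only [gain, inner_add_right, inner_sub_right]
  have := parallelogram_law_with_norm ℝ (inner ℂ (S.h k) u) (inner ℂ (S.h k) v)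
  nlinarith [this]

/-- Total received signal power `∑ⱼ h_kᴴ F_j h_k`. -/
def total (k : Fin K) (F : Fin K → Matrix (Fin N) (Fin N) ℂ) : ℝ := ∑ j, S.quad k (F j)

/-- The left-hand side of the SINR constraint of `OP1`. -/
def margin (k : Fin K) (F : Fin K → Matrix (Fin N) (Fin N) ℂ) : ℝ :=
  S.quad k (F k) / S.γ k - ∑ j ∈ Finset.univ.erase k, S.quad k (F j)

theorem margin_eq (k : Fin K) (F : Fin K → Matrix (Fin N) (Fin N) ℂ) :
    S.margin k F = (1 + 1 / S.γ k) * S.quad k (F k) - S.total k F := by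
  rw [margin, total, ← Finset.add_sum_erase _ _ (Finset.mem_univ k)]
  ring

theorem total_add (k : Fin K) (F G : Fin K → Matrix (Fin N) (Fin N) ℂ) :
    S.total k (F + G) = S.total k F + S.total k G := by
  simp [total, quad_add, Finset.sum_add_distrib]

theorem total_smul (k : Fin K) (t : ℝ) (F : Fin K → Matrix (Fin N) (Fin N) ℂ) :
    S.total k (t • F) = t * S.total k F := by
  simp [total, quad_smul, Finset.mul_sum]

theorem margin_add (k : Fin K) (F G : Fin K → Matrix (Fin N) (Fin N) ℂ) :
    S.margin k (F + G) = S.margin k F + S.margin k G := by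
  rw [margin_eq, margin_eq, margin_eq, total_add, Pi.add_apply, quad_add]; ring

theorem margin_smul (k : Fin K) (t : ℝ) (F : Fin K → Matrix (Fin N) (Fin N) ℂ) :
    S.margin k (t • F) = t * S.margin k F := by
  rw [margin_eq, margin_eq, total_smul, Pi.smul_apply, quad_smul]; ring

/-- The convex set of positive semidefinite families within the power budget. -/
def budgetSet : Set (Fin K → Matrix (Fin N) (Fin N) ℂ) :=
  {F | (∀ k, (F k).PosSemidef) ∧ ∑ k, (F k).trace.re ≤ S.PT}

theorem convex_budgetSet : Convex ℝ S.budgetSet := by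
  intro F hF G hG a b ha hb hab
  refine ⟨fun k => ?_, ?_⟩
  · exact ((hF.1 k).smul ha).add ((hG.1 k).smul hb)
  · have : ∑ k, ((a • F + b • G) k).trace.re =
        a * ∑ k, (F k).trace.re + b * ∑ k, (G k).trace.re := by
      simp [Matrix.trace_add, Matrix.trace_smul, Finset.sum_add_distrib, Finset.mul_sum]
    rw [this]
    calc _ ≤ a * S.PT + b * S.PT := by gcongr; exacts [hF.2, hG.2]
      _ = S.PT := by rw [← add_mul, hab, one_mul]

/-- The constraints of `OP1` with denominators cleared. -/
theorem feasibleOP1_iff {P : ℝ} {F : Fin K → Matrix (Fin N) (Fin N) ℂ} {ρ : Fin K → ℝ} :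
    S.FeasibleOP1 P F ρ ↔ F ∈ S.budgetSet ∧ (∀ k, 0 ≤ ρ k ∧ ρ k ≤ 1) ∧
      (∀ k, P ≤ (1 - ρ k) * (S.total k F + S.σa k ^ 2)) ∧
      ∀ k, S.σd k ^ 2 ≤ ρ k * (S.margin k F - S.σa k ^ 2) := by
  constructor
  · intro h
    refine ⟨⟨h.psd, h.budget⟩, h.split, fun k => ?_, fun k => ?_⟩
    · rcases (h.split k).2.lt_or_eq with h1 | h1
      · have := (h.harvest k).1 h1
        rwa [div_le_iff₀' (by linarith)] at this
      · have := (h.harvest k).2 h1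
        simpa [h1] using this
    · obtain ⟨h0, h1⟩ := h.sinr k
      rw [mul_comm, ← div_le_iff₀ h0]
      unfold margin
      linarith
  · rintro ⟨⟨h1, h2⟩, h3, h4, h5⟩
    have hpos : ∀ k, 0 < ρ k := fun k => by
      rcases (h3 k).1.lt_or_eq with h | h
      · exact h
      · have := h5 k
        rw [← h, zero_mul] at this
        have := pow_pos (S.σd_pos k) 2
        linarith
    refine ⟨h3, fun k => ⟨fun h => ?_, fun h => ?_⟩, fun k => ⟨hpos k, ?_⟩, h2, h1⟩
    · rw [div_le_iff₀' (by linarith)]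
      exact h4 k
    · simpa [h] using h4 k
    · have := h5 k
      rw [mul_comm, ← div_le_iff₀ (hpos k)] at this
      unfold margin at this
      linarith

variable {S}

theorem total_nonneg {F : Fin K → Matrix (Fin N) (Fin N) ℂ} (hF : F ∈ S.budgetSet) (k : Fin K) :
    0 ≤ S.total k F :=
  Finset.sum_nonneg fun j _ => S.quad_nonneg k (hF.1 j)

theorem FeasibleOP1.zero {P : ℝ} {F : Fin K → Matrix (Fin N) (Fin N) ℂ} {ρ : Fin K → ℝ}
    (h : S.FeasibleOP1 P F ρ) : S.FeasibleOP1 0 F ρ := by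
  rw [feasibleOP1_iff] at h ⊢
  refine ⟨h.1, h.2.1, fun k => ?_, h.2.2.2⟩
  have h1 := total_nonneg h.1 k
  exact mul_nonneg (by linarith [(h.2.1 k).2]) (by positivity)

theorem IsOptimalOP1.nonneg {P : ℝ} {F : Fin K → Matrix (Fin N) (Fin N) ℂ} {ρ : Fin K → ℝ}
    (h : S.IsOptimalOP1 P F ρ) : 0 ≤ P := h.2 _ _ _ h.1.zero

theorem FeasibleOP1.margin_pos {P : ℝ} {F : Fin K → Matrix (Fin N) (Fin N) ℂ} {ρ : Fin K → ℝ}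
    (h : S.FeasibleOP1 P F ρ) (k : Fin K) : 0 < S.margin k F - S.σa k ^ 2 := by
  have h1 := (h.sinr k).1
  have h2 := (S.feasibleOP1_iff.mp h).2.2.2 k
  have h3 := pow_pos (S.σd_pos k) 2
  exact pos_of_mul_pos_right (h3.trans_le h2) h1.le

theorem FeasibleOP1.quad_pos {P : ℝ} {F : Fin K → Matrix (Fin N) (Fin N) ℂ} {ρ : Fin K → ℝ}
    (h : S.FeasibleOP1 P F ρ) (k : Fin K) : 0 < S.quad k (F k) := by
  have h1 := h.margin_pos k
  have h2 := sq_nonneg (S.σa k)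
  have h3 := total_nonneg (S.feasibleOP1_iff.mp h).1 k
  rw [margin_eq] at h1
  have h4 : 0 < 1 + 1 / S.γ k := by have := S.γ_pos k; positivity
  exact pos_of_mul_pos_right (by linarith) h4.le

/-- If every user has strict room in the harvesting constraint, `P` can be increased. -/
theorem exists_feasibleOP1_gt (hK : 0 < K) {P : ℝ} {F : Fin K → Matrix (Fin N) (Fin N) ℂ}
    {ρ : Fin K → ℝ} (h : S.FeasibleOP1 P F ρ)
    (hlt : ∀ k, P < (1 - ρ k) * (S.total k F + S.σa k ^ 2)) :
    ∃ P', P < P' ∧ S.FeasibleOP1 P' F ρ := by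
  have : Nonempty (Fin K) := ⟨⟨0, hK⟩⟩
  obtain ⟨k, hk⟩ := Finite.exists_min fun k => (1 - ρ k) * (S.total k F + S.σa k ^ 2)
  rw [feasibleOP1_iff] at h
  exact ⟨_, hlt k, S.feasibleOP1_iff.mpr ⟨h.1, h.2.1, hk, h.2.2.2⟩⟩

end

/-! ### First-order optimality and Lagrange multipliers -/

section

variable (S : SwiptSystem K N)

/-- The combination of margin and received power that governs first-order improvements when the
splitting ratios are adapted; `r k` is the exchange rate between the two. -/
def balance (r : Fin K → ℝ) (k : Fin K) (F : Fin K → Matrix (Fin N) (Fin N) ℂ) : ℝ :=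
  S.margin k F + r k * S.total k F

theorem balance_add (r : Fin K → ℝ) (k : Fin K) (F G : Fin K → Matrix (Fin N) (Fin N) ℂ) :
    S.balance r k (F + G) = S.balance r k F + S.balance r k G := by
  simp only [balance, margin_add, total_add]; ring

theorem balance_smul (r : Fin K → ℝ) (k : Fin K) (t : ℝ)
    (F : Fin K → Matrix (Fin N) (Fin N) ℂ) :
    S.balance r k (t • F) = t * S.balance r k F := by
  simp only [balance, margin_smul, total_smul]; ring

/-- The exchange rate between margin and received power at the point `(F, ρ)`. -/
def exchangeRate (F : Fin K → Matrix (Fin N) (Fin N) ℂ) (ρ : Fin K → ℝ) (k : Fin K) : ℝ :=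
  (S.margin k F - S.σa k ^ 2) * (1 - ρ k) / (ρ k * (S.total k F + S.σa k ^ 2))

variable {S}

/-- If every balance on `s` grew, a short step towards `G` with suitably moved ratios would give all
users strict harvesting room, and `P` could be raised. Users outside `s` are slack, so they tolerate
any short step with `ρ k` fixed. -/
theorem IsOptimalOP1.exists_balance_le (hK : 0 < K) {P : ℝ}
    {F : Fin K → Matrix (Fin N) (Fin N) ℂ} {ρ : Fin K → ℝ} (h : S.IsOptimalOP1 P F ρ)
    {s : Set (Fin K)}
    (hs : ∀ k ∉ s, P < (1 - ρ k) * (S.total k F + S.σa k ^ 2) ∧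
      S.σd k ^ 2 < ρ k * (S.margin k F - S.σa k ^ 2))
    {G : Fin K → Matrix (Fin N) (Fin N) ℂ} (hG : G ∈ S.budgetSet) :
    ∃ k ∈ s, S.balance (S.exchangeRate F ρ) k G ≤ S.balance (S.exchangeRate F ρ) k F := by
  by_contra! hlt
  obtain ⟨hF, hρ, hP, hd⟩ := S.feasibleOP1_iff.mp h.1
  set D := G - F with hD
  have hGD : G = F + D := by rw [hD]; abel
  have key : ∀ k, ∃ δ, ∀ᶠ t in 𝓝[>] (0 : ℝ), (0 ≤ ρ k + t * δ ∧ ρ k + t * δ ≤ 1) ∧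
      P < (1 - (ρ k + t * δ)) * ((S.total k F + S.σa k ^ 2) + t * S.total k D) ∧
      S.σd k ^ 2 ≤ (ρ k + t * δ) * ((S.margin k F - S.σa k ^ 2) + t * S.margin k D) := by
    intro k
    by_cases hk : k ∈ s
    · refine exists_direction_of_pos ?_ (h.1.margin_pos k) (h.1.sinr k).1 (hρ k).2 (hP k) (hd k) ?_
      · have := total_nonneg hF k
        have := pow_pos (S.σa_pos k) 2
        positivity
      · have := hlt k hk
        rw [hGD, balance_add] at this
        have h2 : 0 < S.balance (S.exchangeRate F ρ) k D := by linarith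
        exact h2
    · refine ⟨0, ?_⟩
      filter_upwards [eventually_of_strict (S.total k D) (S.margin k D) (hs k hk).1 (hs k hk).2]
        with t ht
      simpa [hρ k] using ht
  choose δ hδ using key
  have h1 : ∀ᶠ t in 𝓝[>] (0 : ℝ), t < 1 :=
    (eventually_lt_nhds zero_lt_one).filter_mono nhdsWithin_le_nhds
  have h2 : ∀ᶠ t in 𝓝[>] (0 : ℝ), 0 < t := self_mem_nhdsWithin
  obtain ⟨t, ht, ht1, ht0⟩ := ((eventually_all.mpr hδ).and (h1.and h2)).exists
  have hfeas : S.FeasibleOP1 P (F + t • D) (fun k => ρ k + t * δ k) := by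
    refine S.feasibleOP1_iff.mpr ⟨?_, fun k => (ht k).1, fun k => ?_, fun k => ?_⟩
    · exact S.convex_budgetSet.add_smul_sub_mem hF hG ⟨ht0.le, ht1.le⟩
    · rw [total_add, total_smul]
      have := (ht k).2.1
      rw [add_right_comm]
      exact this.le
    · rw [margin_add, margin_smul]
      have := (ht k).2.2
      rwa [add_sub_right_comm]
  obtain ⟨P', hP', hf⟩ := exists_feasibleOP1_gt hK hfeas fun k => by
    rw [total_add, total_smul, add_right_comm]
    exact (ht k).2.1
  exact absurd (h.2 _ _ _ hf) (not_le.mpr hP')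

variable (S)

/-- The `j`-th block of the Lagrangian, as a linear functional of the matrix `F_j`. -/
def lagrangian (ν : ℝ) (μ w : Fin K → ℝ) (j : Fin K) (M : Matrix (Fin N) (Fin N) ℂ) : ℝ :=
  ν * M.trace.re + ∑ k, μ k * w k * S.quad k M - μ j * (1 + 1 / S.γ j) * S.quad j M

theorem lagrangian_add (ν : ℝ) (μ w : Fin K → ℝ) (j : Fin K) (A B : Matrix (Fin N) (Fin N) ℂ) :
    S.lagrangian ν μ w j (A + B) = S.lagrangian ν μ w j A + S.lagrangian ν μ w j B := by
  simp only [lagrangian, quad_add, Matrix.trace_add, Complex.add_re, mul_add,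
    Finset.sum_add_distrib]
  ring

theorem lagrangian_smul (ν : ℝ) (μ w : Fin K → ℝ) (j : Fin K) (t : ℝ)
    (A : Matrix (Fin N) (Fin N) ℂ) :
    S.lagrangian ν μ w j (t • A) = t * S.lagrangian ν μ w j A := by
  have : ∑ k, μ k * w k * (t * S.quad k A) = t * ∑ k, μ k * w k * S.quad k A := by
    rw [Finset.mul_sum]; exact Finset.sum_congr rfl fun k _ => by ring
  simp only [lagrangian, quad_smul, Matrix.trace_smul, Complex.real_smul, Complex.re_ofReal_mul,
    this]
  ring

theorem lagrangian_zero (ν : ℝ) (μ w : Fin K → ℝ) (j : Fin K) :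
    S.lagrangian ν μ w j 0 = 0 := by
  simpa using S.lagrangian_smul ν μ w j 0 0

theorem lagrangian_sum (ν : ℝ) (μ w : Fin K → ℝ) (j : Fin K) {ι : Type*} (s : Finset ι)
    (A : ι → Matrix (Fin N) (Fin N) ℂ) :
    S.lagrangian ν μ w j (∑ i ∈ s, A i) = ∑ i ∈ s, S.lagrangian ν μ w j (A i) := by
  classical
  induction s using Finset.induction_on with
  | empty => simp [lagrangian_zero]
  | insert a s ha ih => rw [Finset.sum_insert ha, Finset.sum_insert ha, lagrangian_add, ih]

theorem sum_lagrangian (ν : ℝ) (μ r : Fin K → ℝ) (G : Fin K → Matrix (Fin N) (Fin N) ℂ) :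
    ∑ j, S.lagrangian ν μ (fun k => 1 - r k) j (G j) =
      ν * ∑ j, (G j).trace.re - ∑ k, μ k * S.balance r k G := by
  have h1 : ∑ j, ∑ k, μ k * (1 - r k) * S.quad k (G j) = ∑ k, μ k * (1 - r k) * S.total k G := by
    rw [Finset.sum_comm]
    exact Finset.sum_congr rfl fun k _ => by rw [total, Finset.mul_sum]
  have h2 : ∑ k, μ k * S.balance r k G = ∑ k, μ k * (1 + 1 / S.γ k) * S.quad k (G k) -
      ∑ k, μ k * (1 - r k) * S.total k G := by
    rw [← Finset.sum_sub_distrib]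
    exact Finset.sum_congr rfl fun k _ => by rw [balance, margin_eq]; ring
  simp only [lagrangian, Finset.sum_sub_distrib, Finset.sum_add_distrib, h1, h2, Finset.mul_sum]
  ring

variable {S}

theorem lagrangian_nonneg {ν : ℝ} {μ w : Fin K → ℝ} {j : Fin K}
    (hz : ∀ v, 0 ≤ S.lagrangian ν μ w j (outer v)) {M : Matrix (Fin N) (Fin N) ℂ}
    (hM : M.PosSemidef) : 0 ≤ S.lagrangian ν μ w j M := by
  obtain ⟨v, rfl⟩ := exists_sum_outer hM
  rw [lagrangian_sum]
  exact Finset.sum_nonneg fun i _ => hz _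

theorem trace_re_nonneg {M : Matrix (Fin N) (Fin N) ℂ} (hM : M.PosSemidef) : 0 ≤ M.trace.re := by
  obtain ⟨v, rfl⟩ := exists_sum_outer hM
  rw [Matrix.trace_sum, Complex.re_sum]
  exact Finset.sum_nonneg fun i _ => by rw [trace_outer]; positivity

theorem FeasibleOP1.budget_pos (hK : 0 < K) {P : ℝ} {F : Fin K → Matrix (Fin N) (Fin N) ℂ}
    {ρ : Fin K → ℝ} (h : S.FeasibleOP1 P F ρ) : 0 < S.PT := by
  let k : Fin K := ⟨0, hK⟩
  have hq := h.quad_pos k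
  have h1 : 0 < (F k).trace.re := by
    refine (trace_re_nonneg (h.psd k)).lt_of_ne fun h0 => hq.ne' ?_
    obtain ⟨v, hv⟩ := exists_sum_outer (h.psd k)
    rw [hv, Matrix.trace_sum, Complex.re_sum, eq_comm,
      Finset.sum_eq_zero_iff_of_nonneg fun i _ => by rw [trace_outer]; positivity] at h0
    rw [hv, quad_sum]
    refine Finset.sum_eq_zero fun i hi => ?_
    have h2 := h0 i hi
    rw [trace_outer, sq_eq_zero_iff, norm_eq_zero] at h2
    rw [quad_outer, h2]
    simp [gain]
  exact (h1.trans_le (Finset.single_le_sum (f := fun k => (F k).trace.re)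
    (fun i _ => trace_re_nonneg (h.psd i)) (Finset.mem_univ k))).trans_le h.budget

/-- Lagrange multipliers at an optimal point, carried by the users that are not slack in both
constraints. -/
theorem IsOptimalOP1.exists_multipliers (hK : 0 < K) {P : ℝ}
    {F : Fin K → Matrix (Fin N) (Fin N) ℂ} {ρ : Fin K → ℝ} (h : S.IsOptimalOP1 P F ρ)
    {s : Set (Fin K)}
    (hs : ∀ k ∉ s, P < (1 - ρ k) * (S.total k F + S.σa k ^ 2) ∧
      S.σd k ^ 2 < ρ k * (S.margin k F - S.σa k ^ 2)) :
    ∃ (ν : ℝ) (μ w : Fin K → ℝ), 0 < ν ∧ (∀ k, 0 ≤ μ k) ∧ (∀ k ∉ s, μ k = 0) ∧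
      (∀ j v, 0 ≤ S.lagrangian ν μ w j (outer v)) ∧
      ∑ j, S.lagrangian ν μ w j (F j) ≤ 0 := by
  obtain ⟨hF, hρ, hP, hd⟩ := S.feasibleOP1_iff.mp h.1
  set r := S.exchangeRate F ρ with hr
  obtain ⟨μ, hμ0, hμs, ⟨i, hi⟩, hμ⟩ := exists_weights_of_convex
    (T := (fun G k => S.balance r k G - S.balance r k F) '' S.budgetSet)
    (by
      rintro _ ⟨G, hG, rfl⟩ _ ⟨H, hH, rfl⟩ a b ha hb hab
      refine ⟨a • G + b • H, S.convex_budgetSet hG hH ha hb hab, ?_⟩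
      ext k
      simp only [balance_add, balance_smul, Pi.add_apply, Pi.smul_apply, smul_eq_mul]
      linear_combination (S.balance r k F) * hab)
    ⟨F, hF, by ext; simp⟩ s
    (by
      rintro _ ⟨G, hG, rfl⟩
      obtain ⟨k, hk, hle⟩ := h.exists_balance_le hK hs hG
      exact ⟨k, hk, sub_nonpos.mpr hle⟩)
  -- Positivity of the balances gives `V > 0`, hence a positive power price `V / S.PT`.
  have hb : ∀ k, 0 < S.balance r k F := fun k => by
    have h1 := h.1.margin_pos k
    have h2 := total_nonneg hF k
    have h3 : 0 ≤ r k := by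
      rw [hr, exchangeRate]
      have := (hρ k).1
      have : 0 ≤ 1 - ρ k := sub_nonneg.mpr (hρ k).2
      positivity
    have h4 := pow_pos (S.σa_pos k) 2
    have := mul_nonneg h3 h2
    rw [balance]; linarith
  set V := ∑ k, μ k * S.balance r k F with hV
  have hVpos : 0 < V := Finset.sum_pos' (fun k _ => mul_nonneg (hμ0 k) (hb k).le)
    ⟨i, Finset.mem_univ i, mul_pos hi (hb i)⟩
  have hPT := h.1.budget_pos hK
  have hle : ∀ G ∈ S.budgetSet, ∑ k, μ k * S.balance r k G ≤ V := fun G hG => by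
    have := hμ _ ⟨G, hG, rfl⟩
    simp only [mul_sub, Finset.sum_sub_distrib] at this
    linarith
  have hνV : V / S.PT * S.PT = V := div_mul_cancel₀ _ hPT.ne'
  refine ⟨V / S.PT, μ, fun k => 1 - r k, by positivity, hμ0, hμs, fun j v => ?_, ?_⟩
  · rcases eq_or_ne v 0 with rfl | hv
    · have : outer (0 : EuclideanSpace ℂ (Fin N)) = 0 := by ext; simp [outer, Matrix.vecMulVec]
      rw [this, lagrangian_zero]
    · have hvp : 0 < ‖v‖ ^ 2 := by have := norm_pos_iff.mpr hv; positivity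
      set t := S.PT / ‖v‖ ^ 2 with ht
      have htp : 0 < t := by positivity
      -- The whole budget is spent in direction `v` on user `j`, so the power term of the Lagrangian
      -- equals `V`.
      set G : Fin K → Matrix (Fin N) (Fin N) ℂ := Pi.single j (t • outer v) with hGdef
      have hGj : G j = t • outer v := Pi.single_eq_same _ _
      have hGn : ∀ i ≠ j, G i = 0 := fun i hi => Pi.single_eq_of_ne hi _
      have htr : ∑ i, (G i).trace.re = S.PT := by
        rw [Finset.sum_eq_single j (fun i _ hi => by simp [hGn i hi]) (by simp), hGj,
          Matrix.trace_smul, Complex.real_smul, Complex.re_ofReal_mul, trace_outer, ht,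
          div_mul_cancel₀ _ hvp.ne']
      have hG : G ∈ S.budgetSet := by
        refine ⟨fun i => ?_, htr.le⟩
        by_cases hij : i = j
        · rw [hij, hGj]; exact (posSemidef_outer v).smul htp.le
        · rw [hGn i hij]; exact Matrix.PosSemidef.zero
      have h1 := S.sum_lagrangian (V / S.PT) μ r G
      rw [htr, hνV, Finset.sum_eq_single j
        (fun i _ hi => by rw [hGn i hi, lagrangian_zero]) (by simp), hGj, lagrangian_smul] at h1
      have h2 : 0 ≤ t * S.lagrangian (V / S.PT) μ (fun k => 1 - r k) j (outer v) := by
        rw [h1]; linarith [hle G hG]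
      exact nonneg_of_mul_nonneg_right h2 htp
  · rw [sum_lagrangian]
    have := mul_le_mul_of_nonneg_left hF.2 (show 0 ≤ V / S.PT by positivity)
    linarith

variable (S) in
theorem lagrangian_outer (ν : ℝ) (μ w : Fin K → ℝ) (j : Fin K) (v : EuclideanSpace ℂ (Fin N)) :
    S.lagrangian ν μ w j (outer v) =
      ν * ‖v‖ ^ 2 + ∑ k, μ k * w k * S.gain k v - μ j * (1 + 1 / S.γ j) * S.gain j v := by
  simp only [lagrangian, trace_outer, quad_outer]

/-- Comparing block `j` with the others at the same vector replaces positive definiteness of the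
common part, which is not available directly because no sign is imposed on `w`. -/
theorem eq_zero_of_lagrangian_eq_zero {ν : ℝ} {μ w : Fin K → ℝ} (hν : 0 < ν) (hμ : ∀ k, 0 ≤ μ k)
    (hz : ∀ j v, 0 ≤ S.lagrangian ν μ w j (outer v)) {j : Fin K} {u : EuclideanSpace ℂ (Fin N)}
    (hu : S.lagrangian ν μ w j (outer u) = 0) (hj : μ j * S.gain j u = 0) : u = 0 := by
  rw [lagrangian_outer] at hu
  have hc : ∀ i, 0 < 1 + 1 / S.γ i := fun i => by have := S.γ_pos i; positivity
  have h1 : ∀ i, μ i * S.gain i u = 0 := fun i => by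
    have h2 := hz i u
    rw [lagrangian_outer] at h2
    refine le_antisymm ?_ (mul_nonneg (hμ i) (S.gain_nonneg i u))
    have h3 : 0 ≤ (1 + 1 / S.γ i) * (-(μ i * S.gain i u)) := by
      linear_combination h2 + hu + (1 + 1 / S.γ j) * hj
    have := nonneg_of_mul_nonneg_right h3 (hc i)
    linarith
  have h2 : ∑ k, μ k * w k * S.gain k u = 0 :=
    Finset.sum_eq_zero fun k _ => by linear_combination w k * h1 k
  rw [h2] at hu
  have h3 : ν * ‖u‖ ^ 2 = 0 := by linear_combination hu + (1 + 1 / S.γ j) * hj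
  simpa [hν.ne'] using h3

/-- The zeros of a nonnegative quadratic form are closed under subtraction, by the parallelogram
law. -/
theorem lagrangian_outer_sub_eq_zero {ν : ℝ} {μ w : Fin K → ℝ} {j : Fin K}
    (hz : ∀ v, 0 ≤ S.lagrangian ν μ w j (outer v)) {u v : EuclideanSpace ℂ (Fin N)}
    (hu : S.lagrangian ν μ w j (outer u) = 0) (hv : S.lagrangian ν μ w j (outer v) = 0) :
    S.lagrangian ν μ w j (outer (u - v)) = 0 := by
  have h : S.lagrangian ν μ w j (outer (u + v)) + S.lagrangian ν μ w j (outer (u - v)) =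
      2 * (S.lagrangian ν μ w j (outer u) + S.lagrangian ν μ w j (outer v)) := by
    have h1 := parallelogram_law_with_norm ℂ u v
    have h2 : ∑ k, μ k * w k * S.gain k (u + v) + ∑ k, μ k * w k * S.gain k (u - v) =
        2 * (∑ k, μ k * w k * S.gain k u + ∑ k, μ k * w k * S.gain k v) := by
      rw [← Finset.sum_add_distrib, ← Finset.sum_add_distrib, Finset.mul_sum]
      exact Finset.sum_congr rfl fun k _ => by
        linear_combination μ k * w k * S.gain_parallelogram k u v
    simp only [lagrangian_outer]
    linear_combination ν * h1 + h2 - μ j * (1 + 1 / S.γ j) * S.gain_parallelogram j u v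
  linarith [hz (u + v), hz (u - v)]

/-- Matrices annihilated by a block of the Lagrangian are multiples of one rank-one matrix. -/
theorem eq_quad_smul_outer {ν : ℝ} {μ w : Fin K → ℝ} (hν : 0 < ν) (hμ : ∀ k, 0 ≤ μ k)
    (hz : ∀ j v, 0 ≤ S.lagrangian ν μ w j (outer v)) {j : Fin K} {u : EuclideanSpace ℂ (Fin N)}
    (hu : S.lagrangian ν μ w j (outer u) = 0) (hu1 : inner ℂ (S.h j) u = 1)
    {M : Matrix (Fin N) (Fin N) ℂ} (hM : M.PosSemidef) (hM0 : S.lagrangian ν μ w j M = 0) :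
    M = S.quad j M • outer u := by
  obtain ⟨v, rfl⟩ := exists_sum_outer hM
  rw [lagrangian_sum, Finset.sum_eq_zero_iff_of_nonneg fun i _ => hz j (v i)] at hM0
  rw [quad_sum, Finset.sum_smul]
  refine Finset.sum_congr rfl fun i hi => ?_
  set c : ℂ := inner ℂ (S.h j) (v i) with hc
  -- The difference is a zero of block `j` orthogonal to `S.h j`.
  have h1 : v i - c • u = 0 := by
    refine eq_zero_of_lagrangian_eq_zero hν hμ hz (j := j)
      (lagrangian_outer_sub_eq_zero (hz j) (hM0 i hi) ?_) ?_
    · rw [outer_smul, lagrangian_smul, hu, mul_zero]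
    · rw [gain, inner_sub_right, inner_smul_right, hu1, hc]
      simp
  rw [sub_eq_zero] at h1
  rw [quad_outer, gain, ← hc]
  conv_lhs => rw [h1, outer_smul]

theorem exists_inner_eq_one {ν : ℝ} {μ w : Fin K → ℝ}
    (hz : ∀ j v, 0 ≤ S.lagrangian ν μ w j (outer v)) {j : Fin K}
    {M : Matrix (Fin N) (Fin N) ℂ} (hM : M.PosSemidef) (hM0 : S.lagrangian ν μ w j M = 0)
    (hq : 0 < S.quad j M) :
    ∃ u, S.lagrangian ν μ w j (outer u) = 0 ∧ inner ℂ (S.h j) u = 1 := by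
  obtain ⟨v, rfl⟩ := exists_sum_outer hM
  rw [lagrangian_sum, Finset.sum_eq_zero_iff_of_nonneg fun i _ => hz j (v i)] at hM0
  rw [quad_sum] at hq
  obtain ⟨i, hi, hne⟩ := Finset.exists_ne_zero_of_sum_ne_zero hq.ne'
  rw [quad_outer, gain] at hne
  have hc : inner ℂ (S.h j) (v i) ≠ 0 := by
    intro h0; rw [h0] at hne; simp at hne
  refine ⟨(inner ℂ (S.h j) (v i))⁻¹ • v i, ?_, ?_⟩
  · rw [outer_smul, lagrangian_smul, hM0 i hi, mul_zero]
  · rw [inner_smul_right, inv_mul_cancel₀ hc]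

end

/-! ### Tight SINR constraints and uniqueness -/

section

variable {S : SwiptSystem K N}

/-- A slack SINR constraint lets `ρ k` be lowered slightly, making user `k` slack in both
constraints while the point stays optimal. Then `μ k = 0`, so block `k` has only the zero vector as
a zero, although `F k ≠ 0` lies on its kernel. -/
theorem IsOptimalOP1.margin_tight (hK : 0 < K) {P : ℝ}
    {F : Fin K → Matrix (Fin N) (Fin N) ℂ} {ρ : Fin K → ℝ} (h : S.IsOptimalOP1 P F ρ)
    (k : Fin K) : ρ k * (S.margin k F - S.σa k ^ 2) = S.σd k ^ 2 := by
  obtain ⟨hF, hρ, hP, hd⟩ := S.feasibleOP1_iff.mp h.1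
  refine le_antisymm (not_lt.mp fun hlt => ?_) (hd k)
  have hs := h.1.margin_pos k
  obtain ⟨ρk, h1, h2⟩ := exists_between ((div_lt_iff₀ hs).mpr hlt)
  have hd0 := pow_pos (S.σd_pos k) 2
  have hρk : 0 < ρk := (div_pos hd0 hs).trans h1
  have hT : 0 < S.total k F + S.σa k ^ 2 := by
    have := total_nonneg hF k
    have := pow_pos (S.σa_pos k) 2
    positivity
  have hP' : P < (1 - ρk) * (S.total k F + S.σa k ^ 2) :=
    (hP k).trans_lt (mul_lt_mul_of_pos_right (by linarith) hT)
  have hd' : S.σd k ^ 2 < ρk * (S.margin k F - S.σa k ^ 2) := (div_lt_iff₀ hs).mp h1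
  have hopt : S.IsOptimalOP1 P F (Function.update ρ k ρk) := by
    refine ⟨S.feasibleOP1_iff.mpr ⟨hF, fun i => ?_, fun i => ?_, fun i => ?_⟩, h.2⟩ <;>
    · by_cases hi : i = k
      · subst hi
        rw [Function.update_self]
        first
        | exact ⟨hρk.le, h2.le.trans (hρ i).2⟩
        | exact hP'.le
        | exact hd'.le
      · rw [Function.update_of_ne hi]
        first
        | exact hρ i
        | exact hP i
        | exact hd i
  obtain ⟨ν, μ, w, hν, hμ, hμs, hz, hsum⟩ := hopt.exists_multipliers hK (s := {k}ᶜ) fun i hi => by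
    obtain rfl : i = k := by simpa using hi
    rw [Function.update_self]
    exact ⟨hP', hd'⟩
  have hnn : ∀ j, 0 ≤ S.lagrangian ν μ w j (F j) := fun j => lagrangian_nonneg (hz j) (h.1.psd j)
  have h0 : S.lagrangian ν μ w k (F k) = 0 :=
    (Finset.sum_eq_zero_iff_of_nonneg fun j _ => hnn j).mp
      (le_antisymm hsum (Finset.sum_nonneg fun j _ => hnn j)) k (Finset.mem_univ k)
  obtain ⟨u, hu, hu1⟩ := exists_inner_eq_one hz (h.1.psd k) h0 (h.1.quad_pos k)
  have := eq_zero_of_lagrangian_eq_zero hν hμ hz hu (by rw [hμs k (by simp), zero_mul])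
  rw [this, inner_zero_right] at hu1
  exact zero_ne_one hu1

theorem IsOptimalOP1.midpoint {P : ℝ} {F F' : Fin K → Matrix (Fin N) (Fin N) ℂ}
    {ρ ρ' : Fin K → ℝ} (h : S.IsOptimalOP1 P F ρ) (h' : S.IsOptimalOP1 P F' ρ') :
    S.IsOptimalOP1 P ((2⁻¹ : ℝ) • F + (2⁻¹ : ℝ) • F') (fun k => 2⁻¹ * ρ k + 2⁻¹ * ρ' k) := by
  obtain ⟨hF, hρ, hP, hd⟩ := S.feasibleOP1_iff.mp h.1
  obtain ⟨hF', hρ', hP', hd'⟩ := S.feasibleOP1_iff.mp h'.1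
  refine ⟨S.feasibleOP1_iff.mpr ⟨S.convex_budgetSet hF hF' (by norm_num) (by norm_num)
    (by norm_num), fun k => ?_, fun k => ?_, fun k => ?_⟩, h.2⟩
  · obtain ⟨a, b⟩ := hρ k
    obtain ⟨c, d⟩ := hρ' k
    constructor <;> linarith
  · have h1 := total_nonneg hF k
    have h2 := total_nonneg hF' k
    have h3 := sq_nonneg (S.σa k)
    have := cross_mul_ge h.nonneg (sub_nonneg.mpr (hρ k).2) (sub_nonneg.mpr (hρ' k).2)
      (by linarith) (by linarith) (hP k) (hP' k)
    rw [total_add, total_smul, total_smul]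
    linear_combination this
  · have := cross_mul_ge (sq_nonneg (S.σd k)) (hρ k).1 (hρ' k).1
      (h.1.margin_pos k).le (h'.1.margin_pos k).le (hd k) (hd' k)
    rw [margin_add, margin_smul, margin_smul]
    linear_combination this

theorem IsOptimalOP1.split_unique (hK : 0 < K) {P : ℝ} {F F' : Fin K → Matrix (Fin N) (Fin N) ℂ}
    {ρ ρ' : Fin K → ℝ} (h : S.IsOptimalOP1 P F ρ) (h' : S.IsOptimalOP1 P F' ρ') : ρ = ρ' := by
  funext k
  by_contra hne
  have h1 := (h.midpoint h').margin_tight hK k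
  rw [margin_add, margin_smul, margin_smul] at h1
  have h2 := cross_mul_gt (pow_pos (S.σd_pos k) 2) (h.1.sinr k).1 (h'.1.sinr k).1 hne
    (h.margin_tight hK k).ge (h'.margin_tight hK k).ge
  have h3 : (2⁻¹ * ρ k + 2⁻¹ * ρ' k) *
      (2⁻¹ * S.margin k F + 2⁻¹ * S.margin k F' - S.σa k ^ 2) =
      (2⁻¹ * ρ k + 2⁻¹ * ρ' k) *
      (2⁻¹ * (S.margin k F - S.σa k ^ 2) + 2⁻¹ * (S.margin k F' - S.σa k ^ 2)) := by ring
  linarith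

/-- Two optimal points consist of multiples of the same rank-one matrices. -/
theorem IsOptimalOP1.exists_common_directions (hK : 0 < K) {P : ℝ}
    {F F' : Fin K → Matrix (Fin N) (Fin N) ℂ} {ρ ρ' : Fin K → ℝ} (h : S.IsOptimalOP1 P F ρ)
    (h' : S.IsOptimalOP1 P F' ρ') :
    ∃ u : Fin K → EuclideanSpace ℂ (Fin N),
      ∀ j, F j = S.quad j (F j) • outer (u j) ∧ F' j = S.quad j (F' j) • outer (u j) := by
  -- Multipliers are taken at the midpoint: the Lagrangian is linear and nonnegative on each family,
  -- so vanishing there forces vanishing on both.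
  obtain ⟨ν, μ, w, hν, hμ, -, hz, hsum⟩ :=
    (h.midpoint h').exists_multipliers hK (s := Set.univ) fun k hk => absurd (Set.mem_univ k) hk
  have hn : ∀ j, 0 ≤ S.lagrangian ν μ w j (F j) := fun j => lagrangian_nonneg (hz j) (h.1.psd j)
  have hn' : ∀ j, 0 ≤ S.lagrangian ν μ w j (F' j) :=
    fun j => lagrangian_nonneg (hz j) (h'.1.psd j)
  have hmid : ∀ j, S.lagrangian ν μ w j (((2⁻¹ : ℝ) • F + (2⁻¹ : ℝ) • F') j) =
      2⁻¹ * S.lagrangian ν μ w j (F j) + 2⁻¹ * S.lagrangian ν μ w j (F' j) := fun j => by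
    rw [Pi.add_apply, lagrangian_add, Pi.smul_apply, Pi.smul_apply, lagrangian_smul,
      lagrangian_smul]
  simp only [hmid] at hsum
  have hn2 : ∀ j, 0 ≤ 2⁻¹ * S.lagrangian ν μ w j (F j) + 2⁻¹ * S.lagrangian ν μ w j (F' j) :=
    fun j => by linarith [hn j, hn' j]
  have h0 : ∀ j, 2⁻¹ * S.lagrangian ν μ w j (F j) + 2⁻¹ * S.lagrangian ν μ w j (F' j) = 0 :=
    fun j => (Finset.sum_eq_zero_iff_of_nonneg fun j _ => hn2 j).mp
      (le_antisymm hsum (Finset.sum_nonneg fun j _ => hn2 j)) j (Finset.mem_univ j)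
  have hF0 : ∀ j, S.lagrangian ν μ w j (F j) = 0 := fun j => by
    linarith [hn j, hn' j, h0 j]
  have hF0' : ∀ j, S.lagrangian ν μ w j (F' j) = 0 := fun j => by
    linarith [hn j, hn' j, h0 j]
  choose u hu hu1 using fun j => exists_inner_eq_one hz (h.1.psd j) (hF0 j) (h.1.quad_pos j)
  exact ⟨u, fun j => ⟨eq_quad_smul_outer hν hμ hz (hu j) (hu1 j) (h.1.psd j) (hF0 j),
    eq_quad_smul_outer hν hμ hz (hu j) (hu1 j) (h'.1.psd j) (hF0' j)⟩⟩

theorem IsOptimalOP1.unique (hK : 0 < K) {P : ℝ} {F F' : Fin K → Matrix (Fin N) (Fin N) ℂ}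
    {ρ ρ' : Fin K → ℝ} (h : S.IsOptimalOP1 P F ρ) (h' : S.IsOptimalOP1 P F' ρ') :
    F' = F ∧ ρ' = ρ := by
  have : Nonempty (Fin K) := ⟨⟨0, hK⟩⟩
  obtain rfl := h.split_unique hK h'
  refine ⟨?_, rfl⟩
  obtain ⟨u, hu⟩ := h.exists_common_directions hK h'
  -- Equal ratios and tight SINR constraints give equal margins; along common directions these form
  -- the linear system of `le_of_diag_sub_eq`, used in both directions.
  have hmargin : ∀ k, S.margin k F = S.margin k F' := fun k => by
    have := mul_left_cancel₀ (h.1.sinr k).1.ne'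
      ((h.margin_tight hK k).trans (h'.margin_tight hK k).symm)
    linarith
  have hexp : ∀ G : Fin K → Matrix (Fin N) (Fin N) ℂ,
      (∀ j, G j = S.quad j (G j) • outer (u j)) → ∀ k, S.margin k G =
      (1 + 1 / S.γ k) * S.quad k (G k) - ∑ j, S.gain k (u j) * S.quad j (G j) := fun G hG k => by
    rw [margin_eq, total]
    congr 1
    refine Finset.sum_congr rfl fun j _ => ?_
    conv_lhs => rw [hG j]
    rw [quad_smul, quad_outer, mul_comm]
  have hF := hexp F fun j => (hu j).1
  have hF' := hexp F' fun j => (hu j).2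
  have hpos : ∀ k, 0 < S.margin k F := fun k => by
    linarith [h.1.margin_pos k, sq_nonneg (S.σa k)]
  have hle := le_of_diag_sub_eq (g := fun i j => S.gain i (u j)) (c := fun i => 1 + 1 / S.γ i)
    (x := fun i => S.quad i (F i)) (y := fun i => S.quad i (F' i))
    (fun i j => S.gain_nonneg i _) h.1.quad_pos (fun i => by rw [← hF]; exact hpos i)
    (fun i => by rw [← hF, ← hF', hmargin])
  have hge := le_of_diag_sub_eq (g := fun i j => S.gain i (u j)) (c := fun i => 1 + 1 / S.γ i)
    (x := fun i => S.quad i (F' i)) (y := fun i => S.quad i (F i))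
    (fun i j => S.gain_nonneg i _) h'.1.quad_pos
    (fun i => by rw [← hF', ← hmargin]; exact hpos i)
    (fun i => by rw [← hF, ← hF', hmargin])
  funext j
  rw [(hu j).1, (hu j).2, le_antisymm (hle j) (hge j)]

theorem IsOptimalOP1.exists_eq_outer (hK : 0 < K) {P : ℝ}
    {F : Fin K → Matrix (Fin N) (Fin N) ℂ} {ρ : Fin K → ℝ} (h : S.IsOptimalOP1 P F ρ) :
    ∃ f : Fin K → EuclideanSpace ℂ (Fin N), ∀ k, F k = outer (f k) := by
  obtain ⟨u, hu⟩ := h.exists_common_directions hK h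
  refine ⟨fun k => ((Real.sqrt (S.quad k (F k)) : ℝ) : ℂ) • u k, fun k => ?_⟩
  rw [outer_smul, Complex.norm_real, Real.norm_eq_abs, sq_abs, Real.sq_sqrt (h.1.quad_pos k).le]
  exact (hu k).1

/-! ### Existence of an optimal point by compactness -/

/-- The family of matrices `∑ᵢ v_{ji} v_{ji}ᴴ`. -/
def sumOuter (v : Fin K → Fin N → EuclideanSpace ℂ (Fin N)) (j : Fin K) :
    Matrix (Fin N) (Fin N) ℂ :=
  ∑ i, outer (v j i)

variable (S) in
theorem continuous_quad_sumOuter (k j : Fin K) :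
    Continuous fun v : Fin K → Fin N → EuclideanSpace ℂ (Fin N) =>
      S.quad k (sumOuter v j) := by
  simp only [sumOuter, quad_sum, quad_outer, gain]
  fun_prop

variable (S) in
theorem continuous_total_sumOuter (k : Fin K) :
    Continuous fun v : Fin K → Fin N → EuclideanSpace ℂ (Fin N) =>
      S.total k (sumOuter v) :=
  continuous_finsetSum _ fun j _ => S.continuous_quad_sumOuter k j

variable (S) in
theorem continuous_margin_sumOuter (k : Fin K) :
    Continuous fun v : Fin K → Fin N → EuclideanSpace ℂ (Fin N) =>
      S.margin k (sumOuter v) := by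
  simp only [margin_eq]
  exact ((S.continuous_quad_sumOuter k k).const_mul _).sub (S.continuous_total_sumOuter k)

theorem posSemidef_sumOuter (v : Fin K → Fin N → EuclideanSpace ℂ (Fin N)) (j : Fin K) :
    (sumOuter v j).PosSemidef :=
  Matrix.posSemidef_sum _ fun i _ => posSemidef_outer (v j i)

theorem trace_sumOuter (v : Fin K → Fin N → EuclideanSpace ℂ (Fin N)) (j : Fin K) :
    (sumOuter v j).trace.re = ∑ i, ‖v j i‖ ^ 2 := by
  rw [sumOuter, Matrix.trace_sum, Complex.re_sum]
  exact Finset.sum_congr rfl fun i _ => trace_outer _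

theorem exists_isOptimalOP1 (hK : 0 < K) (hfeas : ∃ P F ρ, S.FeasibleOP1 P F ρ) :
    ∃ P F ρ, S.IsOptimalOP1 P F ρ := by
  have : Nonempty (Fin K) := ⟨⟨0, hK⟩⟩
  have hne : (Finset.univ : Finset (Fin K)).Nonempty := Finset.univ_nonempty
  -- In terms of factor vectors semidefiniteness is automatic and the trace budget bounds the norms.
  -- `P` is eliminated by maximizing the least received power.
  let X : Set ((Fin K → Fin N → EuclideanSpace ℂ (Fin N)) × (Fin K → ℝ)) :=
    {x | ∑ j, ∑ i, ‖x.1 j i‖ ^ 2 ≤ S.PT ∧ (∀ k, 0 ≤ x.2 k ∧ x.2 k ≤ 1) ∧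
      ∀ k, S.σd k ^ 2 ≤ x.2 k * (S.margin k (sumOuter x.1) - S.σa k ^ 2)}
  have hT := fun k => (S.continuous_total_sumOuter k).comp
    (continuous_fst (X := Fin K → Fin N → EuclideanSpace ℂ (Fin N)) (Y := Fin K → ℝ))
  have hM := fun k => (S.continuous_margin_sumOuter k).comp
    (continuous_fst (X := Fin K → Fin N → EuclideanSpace ℂ (Fin N)) (Y := Fin K → ℝ))
  have hρ := fun k : Fin K => (continuous_apply k).comp
    (continuous_snd (X := Fin K → Fin N → EuclideanSpace ℂ (Fin N)) (Y := Fin K → ℝ))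
  have hclosed : IsClosed X := by
    have h1 : IsClosed {x : (Fin K → Fin N → EuclideanSpace ℂ (Fin N)) × (Fin K → ℝ) |
        ∑ j, ∑ i, ‖x.1 j i‖ ^ 2 ≤ S.PT} := isClosed_le (by fun_prop) continuous_const
    have h2 : ∀ k : Fin K, IsClosed {x : (Fin K → Fin N → EuclideanSpace ℂ (Fin N)) ×
        (Fin K → ℝ) | 0 ≤ x.2 k ∧ x.2 k ≤ 1} := fun k =>
      (isClosed_le continuous_const (hρ k)).inter (isClosed_le (hρ k) continuous_const)
    have h3 : ∀ k : Fin K, IsClosed {x : (Fin K → Fin N → EuclideanSpace ℂ (Fin N)) ×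
        (Fin K → ℝ) | S.σd k ^ 2 ≤ x.2 k * (S.margin k (sumOuter x.1) - S.σa k ^ 2)} := fun k =>
      isClosed_le continuous_const ((hρ k).mul ((hM k).sub continuous_const))
    have : X = {x | ∑ j, ∑ i, ‖x.1 j i‖ ^ 2 ≤ S.PT} ∩ ((⋂ k, {x | 0 ≤ x.2 k ∧ x.2 k ≤ 1}) ∩
        ⋂ k, {x | S.σd k ^ 2 ≤ x.2 k * (S.margin k (sumOuter x.1) - S.σa k ^ 2)}) := by
      ext x; simp [X]
    rw [this]
    exact h1.inter ((isClosed_iInter h2).inter (isClosed_iInter h3))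
  have hcompact : IsCompact X := by
    refine ((isCompact_closedBall (0 : Fin K → Fin N → EuclideanSpace ℂ (Fin N))
      (|S.PT| + 1)).prod (isCompact_Icc (a := (0 : Fin K → ℝ)) (b := 1))).of_isClosed_subset
      hclosed ?_
    rintro ⟨v, ρ⟩ ⟨hv, hρ, -⟩
    refine ⟨?_, fun k => (hρ k).1, fun k => (hρ k).2⟩
    have hr : 0 ≤ |S.PT| + 1 := by positivity
    rw [mem_closedBall_zero_iff, pi_norm_le_iff_of_nonneg hr]
    intro j
    rw [pi_norm_le_iff_of_nonneg hr]
    intro i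
    have h1 : ‖v j i‖ ^ 2 ≤ S.PT := by
      refine le_trans ?_ hv
      refine le_trans ?_ (Finset.single_le_sum (f := fun j => ∑ i, ‖v j i‖ ^ 2)
        (fun j _ => by positivity) (Finset.mem_univ j))
      exact Finset.single_le_sum (f := fun i => ‖v j i‖ ^ 2)
        (fun j _ => by positivity) (Finset.mem_univ i)
    nlinarith [le_abs_self S.PT, abs_nonneg S.PT, norm_nonneg (v j i)]
  have hmem : ∀ {P F ρ}, S.FeasibleOP1 P F ρ → ∃ v, F = sumOuter v ∧ (v, ρ) ∈ X := by
    intro P F ρ h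
    obtain ⟨hF, hρ, -, hd⟩ := S.feasibleOP1_iff.mp h
    choose v hv using fun j => exists_sum_outer (h.psd j)
    have hFv : F = sumOuter v := funext hv
    refine ⟨v, hFv, ?_, hρ, fun k => by rw [← hFv]; exact hd k⟩
    simp only [← trace_sumOuter, ← hFv]
    exact hF.2
  obtain ⟨P₀, F₀, ρ₀, h₀⟩ := hfeas
  obtain ⟨v₀, -, hv₀⟩ := hmem h₀
  obtain ⟨⟨v, ρ⟩, hx, hmax⟩ := hcompact.exists_isMaxOn ⟨_, hv₀⟩
    (f := fun x => Finset.univ.inf' hne fun k : Fin K =>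
      (1 - x.2 k) * (S.total k (sumOuter x.1) + S.σa k ^ 2))
    (Continuous.continuousOn (Continuous.finset_inf'_apply hne fun k _ =>
      (continuous_const.sub (hρ k)).mul ((hT k).add continuous_const)))
  refine ⟨Finset.univ.inf' hne fun k : Fin K => (1 - ρ k) * (S.total k (sumOuter v) + S.σa k ^ 2),
    sumOuter v, ρ, S.feasibleOP1_iff.mpr ⟨⟨posSemidef_sumOuter v, ?_⟩, hx.2.1,
    fun k => Finset.inf'_le (s := Finset.univ) (fun k : Fin K =>
      (1 - ρ k) * (S.total k (sumOuter v) + S.σa k ^ 2)) (Finset.mem_univ k), hx.2.2⟩, ?_⟩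
  · simp only [trace_sumOuter]
    exact hx.1
  · intro P' F' ρ' h'
    obtain ⟨v', rfl, hv'⟩ := hmem h'
    refine le_trans ?_ (hmax hv')
    exact Finset.le_inf' _ _ fun k _ => (S.feasibleOP1_iff.mp h').2.2.1 k

/-! ### Relation between the two problems -/

theorem gamma_le_SINR_iff (f : Fin K → EuclideanSpace ℂ (Fin N)) {ρ : Fin K → ℝ} {k : Fin K}
    (hρ : 0 ≤ ρ k) : S.γ k ≤ S.SINR f ρ k ↔
      S.σd k ^ 2 ≤ ρ k * (S.margin k (fun j => outer (f j)) - S.σa k ^ 2) := by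
  have hI : 0 ≤ ∑ j ∈ Finset.univ.erase k, S.gain k (f j) :=
    Finset.sum_nonneg fun j _ => S.gain_nonneg k _
  have hd := pow_pos (S.σd_pos k) 2
  have hγ := S.γ_pos k
  have hden : 0 < ρ k * (∑ j ∈ Finset.univ.erase k, S.gain k (f j)) + ρ k * S.σa k ^ 2 +
      S.σd k ^ 2 := by positivity
  rw [SINR, le_div_iff₀ hden]
  simp only [margin, quad_outer]
  set I := ∑ j ∈ Finset.univ.erase k, S.gain k (f j)
  rw [← mul_le_mul_iff_right₀ (a := S.γ k) hγ (b := S.σd k ^ 2)]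
  have : S.γ k * (ρ k * (S.gain k (f k) / S.γ k - I - S.σa k ^ 2)) =
      ρ k * S.gain k (f k) - S.γ k * (ρ k * I + ρ k * S.σa k ^ 2) := by
    field_simp
    ring
  rw [this]
  constructor <;> intro h <;> linarith

theorem rxPower_eq (f : Fin K → EuclideanSpace ℂ (Fin N)) (ρ : Fin K → ℝ) (k : Fin K) :
    S.rxPower f ρ k = (1 - ρ k) * (S.total k (fun j => outer (f j)) + S.σa k ^ 2) := by
  simp only [rxPower, total, quad_outer]

theorem feasibleOP1_outer_iff (P : ℝ) (f : Fin K → EuclideanSpace ℂ (Fin N)) (ρ : Fin K → ℝ) :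
    S.FeasibleOP1 P (fun k => outer (f k)) ρ ↔
      S.FeasibleOP f ρ ∧ ∀ k, P ≤ S.rxPower f ρ k := by
  simp only [feasibleOP1_iff, rxPower_eq]
  constructor
  · rintro ⟨h1, h2, h3, h4⟩
    refine ⟨⟨fun k => (gamma_le_SINR_iff f (h2 k).1).mpr (h4 k), ?_, h2⟩, h3⟩
    simpa only [trace_outer] using h1.2
  · rintro ⟨h, h3⟩
    refine ⟨⟨fun k => posSemidef_outer _, ?_⟩, h.split, h3, fun k =>
      (gamma_le_SINR_iff f (h.split k).1).mp (h.sinr k)⟩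
    simpa only [trace_outer] using h.budget

theorem FeasibleOP.rxPower_nonneg {f : Fin K → EuclideanSpace ℂ (Fin N)} {ρ : Fin K → ℝ}
    (h : S.FeasibleOP f ρ) (k : Fin K) : 0 ≤ S.rxPower f ρ k := by
  have h1 : 0 ≤ ∑ j, S.gain k (f j) := Finset.sum_nonneg fun j _ => S.gain_nonneg k _
  exact mul_nonneg (sub_nonneg.mpr (h.split k).2) (by positivity)

theorem FeasibleOP.feasibleOP1_zero {f : Fin K → EuclideanSpace ℂ (Fin N)} {ρ : Fin K → ℝ}
    (h : S.FeasibleOP f ρ) : S.FeasibleOP1 0 (fun k => outer (f k)) ρ :=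
  (feasibleOP1_outer_iff _ _ _).mpr ⟨h, h.rxPower_nonneg⟩

/-- No feasible point of `OP` gives every user more than the optimal value of `OP1`. -/
theorem IsOptimalOP1.exists_rxPower_le (hK : 0 < K) {P : ℝ}
    {F : Fin K → Matrix (Fin N) (Fin N) ℂ} {ρ : Fin K → ℝ} (h : S.IsOptimalOP1 P F ρ)
    {f : Fin K → EuclideanSpace ℂ (Fin N)} {ρ' : Fin K → ℝ} (hf : S.FeasibleOP f ρ') :
    ∃ k, S.rxPower f ρ' k ≤ P := by
  by_contra! hlt
  obtain ⟨P', hP', h'⟩ := exists_feasibleOP1_gt hK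
    ((feasibleOP1_outer_iff P f ρ').mpr ⟨hf, fun k => (hlt k).le⟩)
    fun k => by rw [← rxPower_eq]; exact hlt k
  exact absurd (h.2 _ _ _ h') (not_le.mpr hP')

theorem objOP_le (EH : ℝ → ℝ) (f : Fin K → EuclideanSpace ℂ (Fin N)) (ρ : Fin K → ℝ) (k : Fin K) :
    S.objOP EH f ρ ≤ EH (S.rxPower f ρ k) :=
  ciInf_le (Set.finite_range _).bddBelow k

theorem IsOptimalOP1.objOP_le (hK : 0 < K) {EH : ℝ → ℝ} (hEH : MonotoneOn EH (Set.Ici 0)) {P : ℝ}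
    {F : Fin K → Matrix (Fin N) (Fin N) ℂ} {ρ : Fin K → ℝ} (h : S.IsOptimalOP1 P F ρ)
    {f : Fin K → EuclideanSpace ℂ (Fin N)} {ρ' : Fin K → ℝ} (hf : S.FeasibleOP f ρ') :
    S.objOP EH f ρ' ≤ EH P := by
  obtain ⟨k, hk⟩ := h.exists_rxPower_le hK hf
  exact (SwiptSystem.objOP_le EH f ρ' k).trans (hEH (hf.rxPower_nonneg k) h.nonneg hk)

theorem IsOptimalOP1.isOptimalOP (hK : 0 < K) {EH : ℝ → ℝ} (hEH : MonotoneOn EH (Set.Ici 0))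
    {P : ℝ} {f : Fin K → EuclideanSpace ℂ (Fin N)} {ρ : Fin K → ℝ}
    (h : S.IsOptimalOP1 P (fun k => outer (f k)) ρ) :
    S.IsOptimalOP EH f ρ ∧ S.objOP EH f ρ = EH P := by
  have : Nonempty (Fin K) := ⟨⟨0, hK⟩⟩
  obtain ⟨hf, hP⟩ := (feasibleOP1_outer_iff _ _ _).mp h.1
  have hval : S.objOP EH f ρ = EH P := le_antisymm (h.objOP_le hK hEH hf)
    (le_ciInf fun k => hEH h.nonneg (hf.rxPower_nonneg k) (hP k))
  exact ⟨⟨hf, fun f' ρ' hf' => hval ▸ h.objOP_le hK hEH hf'⟩, hval⟩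

end

end SwiptSystem

end

theorem theorem1 {K N : ℕ} (hK : 0 < K) (S : SwiptSystem K N)
    (EH : ℝ → ℝ) (hEH : MonotoneOn EH (Set.Ici 0)) :
    -- rank-one points of OP1 are exactly the epigraph points of max-min received power over OP
    (∀ (P : ℝ) (f : Fin K → EuclideanSpace ℂ (Fin N)) (ρ : Fin K → ℝ),
      S.FeasibleOP1 P (fun k => SwiptSystem.outer (f k)) ρ ↔
        S.FeasibleOP f ρ ∧ ∀ k, P ≤ S.rxPower f ρ k) ∧
    -- the relaxation does not change feasibility
    ((∃ P F ρ, S.FeasibleOP1 P F ρ) ↔ ∃ f ρ, S.FeasibleOP f ρ) ∧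
    ((∃ f ρ, S.FeasibleOP f ρ) →
      ∃ (P : ℝ) (F : Fin K → Matrix (Fin N) (Fin N) ℂ) (ρ : Fin K → ℝ),
        -- OP1 has exactly one globally optimal solution
        S.IsOptimalOP1 P F ρ ∧
        (∀ P' F' ρ', S.IsOptimalOP1 P' F' ρ' → P' = P ∧ F' = F ∧ ρ' = ρ) ∧
        -- it comes from precoding vectors, and all such vectors solve OP, with value EH P
        (∃ f : Fin K → EuclideanSpace ℂ (Fin N), ∀ k, F k = SwiptSystem.outer (f k)) ∧
        (∀ f : Fin K → EuclideanSpace ℂ (Fin N), (∀ k, F k = SwiptSystem.outer (f k)) →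
          S.IsOptimalOP EH f ρ ∧ S.objOP EH f ρ = EH P) ∧
        -- conversely, unless EH is already flat just below P, each solution of OP is of this form
        ((∀ x, 0 ≤ x → x < P → EH x < EH P) →
          ∀ (f : Fin K → EuclideanSpace ℂ (Fin N)) (ρ' : Fin K → ℝ), S.IsOptimalOP EH f ρ' →
            (∀ k, SwiptSystem.outer (f k) = F k) ∧ ρ' = ρ)) := by
  refine ⟨SwiptSystem.feasibleOP1_outer_iff, ⟨?_, ?_⟩, ?_⟩
  · intro h
    obtain ⟨P, F, ρ, hopt⟩ := SwiptSystem.exists_isOptimalOP1 hK h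
    obtain ⟨f, hf⟩ := hopt.exists_eq_outer hK
    obtain rfl : F = fun k => SwiptSystem.outer (f k) := funext hf
    exact ⟨f, ρ, ((SwiptSystem.feasibleOP1_outer_iff _ _ _).mp hopt.1).1⟩
  · rintro ⟨f, ρ, h⟩
    exact ⟨0, _, ρ, h.feasibleOP1_zero⟩
  · rintro ⟨f₀, ρ₀, h₀⟩
    obtain ⟨P, F, ρ, hopt⟩ := SwiptSystem.exists_isOptimalOP1 hK ⟨0, _, ρ₀, h₀.feasibleOP1_zero⟩
    have huniq : ∀ P' F' ρ', S.IsOptimalOP1 P' F' ρ' → P' = P ∧ F' = F ∧ ρ' = ρ := by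
      intro P' F' ρ' h'
      obtain rfl : P' = P := le_antisymm (hopt.2 _ _ _ h'.1) (h'.2 _ _ _ hopt.1)
      exact ⟨rfl, hopt.unique hK h'⟩
    refine ⟨P, F, ρ, hopt, huniq, hopt.exists_eq_outer hK, fun f hf => ?_, fun hstrict f ρ' h' => ?_⟩
    · obtain rfl : F = fun k => SwiptSystem.outer (f k) := funext hf
      exact hopt.isOptimalOP hK hEH
    · obtain ⟨g, hg⟩ := hopt.exists_eq_outer hK
      obtain rfl : F = fun k => SwiptSystem.outer (g k) := funext hg
      obtain ⟨hgopt, hval⟩ := hopt.isOptimalOP hK hEH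
      have hge : EH P ≤ S.objOP EH f ρ' := hval ▸ h'.2 _ _ hgopt.1
      have hrx : ∀ k, P ≤ S.rxPower f ρ' k := fun k => by
        by_contra! hlt
        exact absurd (hge.trans (SwiptSystem.objOP_le EH f ρ' k))
          (not_le.mpr (hstrict _ (h'.1.rxPower_nonneg k) hlt))
      -- Strictness of `EH` below `P` makes the given solution reach received power `P` at every
      -- user, so its rank-one lift is optimal for `OP1`.
      obtain ⟨-, h1, h2⟩ := huniq P (fun k => SwiptSystem.outer (f k)) ρ'
        ⟨(SwiptSystem.feasibleOP1_outer_iff _ _ _).mpr ⟨h'.1, hrx⟩, hopt.2⟩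
      exact ⟨fun k => congrFun h1 k, h2⟩
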